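/- **Theorem 3.6 (Uncertainty principle).** Let $\mathrm{Ai}(x)=\frac1\pi\int_0^\infty\cos\bigl(\tfrac{t^3}{3}+xt\bigr)\,dt$ ($x\in\mathbb R$, improper integral) be the Airy function of the first kind. Let $a,b\in\mathbb R$, let $\sigma\in L^2(\mathbb R)$ be real-valued and supported on $[a,\infty)$ (that is, $\sigma=0$ almost everywhere on $(-\infty,a)$), and let $f\colon\mathbb R\to\mathbb R$ be the Airy-bandlimited function with Airy transform $\sigma$, that is, $$f(x)=\int_a^\infty \mathrm{Ai}(x+y)\,\sigma(y)\,dy\qquad\text{for all }x\in\mathbb R .$$ Assume that $f$ is not identically zero. Then $0<\int_{-\infty}^\infty f(x)^2\,dx<\infty$, the function $(x,y)\mapsto \mathrm{Ai}(x+y)^2$ is integrable on $(b,\infty)\times(a,\infty)$, and the fraction $$\alpha^2=\frac{\int_b^\infty f(x)^2\,dx}{\int_{-\infty}^\infty f(x)^2\,dx}$$ of the energy of $f$ on $[b,\infty)$ satisfies $$\alpha^2\le\int_b^\infty\!\!\int_a^\infty \mathrm{Ai}(x+y)^2\,dy\,dx .$$ -/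

import Mathlib

/-- The Airy function of the first kind on the real line, as the improper (conditionally
convergent) integral `Ai(x) = (1/π) ∫₀^∞ cos (t³/3 + x t) dt`, that is, the limit of the integrals
over `[0, T]` as `T → ∞`. -/
noncomputable def airyAi (x : ℝ) : ℝ :=
  (1 / Real.pi) *
    Filter.limUnder Filter.atTop (fun T : ℝ => ∫ t in (0 : ℝ)..T, Real.cos (t ^ 3 / 3 + x * t))

/-- `f : ℝ → ℝ` is Airy-bandlimited to `[a, ∞)` with Airy transform `σ`: the function
`σ ∈ L²(ℝ)` is supported on `[a, ∞)` (up to a null set), and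
`f(x) = ∫_a^∞ Ai(x + y) σ(y) dy` for every real `x`. -/
structure IsAiryBandlimited (a : ℝ) (σ f : ℝ → ℝ) : Prop where
  memLp : MeasureTheory.MemLp σ 2 MeasureTheory.volume
  supported : ∀ᵐ y ∂(MeasureTheory.volume : MeasureTheory.Measure ℝ), y < a → σ y = 0
  eq_integral : ∀ x : ℝ, f x = ∫ y in Set.Ioi a, airyAi (x + y) * σ y

open MeasureTheory Filter Topology Set FourierTransform SchwartzMap

/-! The map `σ ↦ ∫ Ai(x + y) σ(y) dy` is multiplication by the unimodular symbol `exp(i (2πu)³/3)`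
between two inverse Fourier transforms (two inverses, since the kernel depends on `x + y` and not `x
- y`). Hence it is an isometry of `L²`, and `∫ f² = ∫_a^∞ σ²`. Cauchy–Schwarz then gives `f(x)² ≤
(∫_a^∞ Ai(x + y)² dy) · ∫ f²` for every `x`. This forces `∫ f² > 0` when `f ≠ 0`, and integrating
over `x > b` and dividing gives the claim.

The work lies in identifying the multiplier with the conditionally convergent kernel. Cutting the
symbol to `[-n, n]` produces exactly the truncated Airy integrals
(`fourierInv_airySymbolTrunc_mul`); bounds uniform in the truncation (`abs_airyPartial_le`) allow
passage to the limit for compactly supported functions, and cutoffs extend the formula to half-lines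
(`coeFn_airyTransform`). Decay of `Ai` at `+∞` makes all the integrals finite. -/

/-! ### Convergence and bounds of the Airy integral -/

/-- The truncation of the Airy integral to `[0, T]`. -/
noncomputable def airyPartial (T x : ℝ) : ℝ := ∫ t in (0 : ℝ)..T, Real.cos (t ^ 3 / 3 + x * t)

lemma hasDerivAt_airyPhase (x t : ℝ) :
    HasDerivAt (fun t : ℝ => t ^ 3 / 3 + x * t) (t ^ 2 + x) t := by
  have := ((hasDerivAt_pow 3 t).div_const 3).add ((hasDerivAt_id t).const_mul x)
  convert! this using 1
  simp

lemma intervalIntegrable_airyPhase (x S T : ℝ) :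
    IntervalIntegrable (fun t : ℝ => Real.cos (t ^ 3 / 3 + x * t)) volume S T :=
  Continuous.intervalIntegrable (by fun_prop) _ _

lemma continuous_airyPartial (T : ℝ) : Continuous (airyPartial T) :=
  intervalIntegral.continuous_parametric_intervalIntegral_of_continuous'
    (f := fun x t : ℝ => Real.cos (t ^ 3 / 3 + x * t)) (by fun_prop) 0 T

lemma airyPartial_sub (x S T : ℝ) :
    airyPartial T x - airyPartial S x = ∫ t in S..T, Real.cos (t ^ 3 / 3 + x * t) :=
  intervalIntegral.integral_interval_sub_left (intervalIntegrable_airyPhase x 0 T)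
    (intervalIntegrable_airyPhase x 0 S)

/-- Integrating by parts once bounds the oscillatory integral beyond the stationary point. -/
lemma abs_airyPartial_sub_le {x S T : ℝ} (hS : 0 ≤ S) (hST : S ≤ T) (hx : 0 < S ^ 2 + x) :
    |airyPartial T x - airyPartial S x| ≤ 2 / (S ^ 2 + x) := by
  rw [airyPartial_sub]
  have hpos : ∀ t ∈ uIcc S T, 0 < t ^ 2 + x := by
    intro t ht
    rw [uIcc_of_le hST] at ht
    nlinarith [ht.1]
  have hcont : ContinuousOn (fun t : ℝ => 2 * t / (t ^ 2 + x) ^ 2) (uIcc S T) :=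
    ContinuousOn.div (by fun_prop) (by fun_prop) fun t ht => (pow_pos (hpos t ht) 2).ne'
  have hcont2 : ContinuousOn
      (fun t : ℝ => Real.sin (t ^ 3 / 3 + x * t) * (2 * t / (t ^ 2 + x) ^ 2)) (uIcc S T) :=
    ContinuousOn.mul (by fun_prop) hcont
  have h1 : ∫ t in S..T, (Real.cos (t ^ 3 / 3 + x * t) -
      Real.sin (t ^ 3 / 3 + x * t) * (2 * t / (t ^ 2 + x) ^ 2)) =
      Real.sin (T ^ 3 / 3 + x * T) / (T ^ 2 + x) - Real.sin (S ^ 3 / 3 + x * S) / (S ^ 2 + x) := by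
    refine intervalIntegral.integral_eq_sub_of_hasDerivAt
      (f := fun t => Real.sin (t ^ 3 / 3 + x * t) / (t ^ 2 + x)) ?_ ?_
    · intro t ht
      have hne := (hpos t ht).ne'
      have := (hasDerivAt_airyPhase x t).sin.div ((hasDerivAt_pow 2 t).add_const x) hne
      convert! this using 1
      field_simp
      simp
      ring
    · exact (intervalIntegrable_airyPhase x S T).sub hcont2.intervalIntegrable
  rw [intervalIntegral.integral_sub (intervalIntegrable_airyPhase x S T)
    hcont2.intervalIntegrable] at h1
  have h2 : ∫ t in S..T, 2 * t / (t ^ 2 + x) ^ 2 = 1 / (S ^ 2 + x) - 1 / (T ^ 2 + x) := by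
    have := intervalIntegral.integral_eq_sub_of_hasDerivAt
      (f := fun t => -(t ^ 2 + x)⁻¹) (f' := fun t => 2 * t / (t ^ 2 + x) ^ 2) (a := S) (b := T) ?_
      hcont.intervalIntegrable
    · rw [this]; simp only [one_div]; ring
    · intro t ht
      have := (((hasDerivAt_pow 2 t).add_const x).inv (hpos t ht).ne').neg
      convert! this using 1
      simp
      ring
  have h3 : |∫ t in S..T, Real.sin (t ^ 3 / 3 + x * t) * (2 * t / (t ^ 2 + x) ^ 2)| ≤
      1 / (S ^ 2 + x) - 1 / (T ^ 2 + x) := by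
    rw [← h2, ← Real.norm_eq_abs]
    refine intervalIntegral.norm_integral_le_of_norm_le hST ?_ hcont.intervalIntegrable
    refine Eventually.of_forall fun t ht => ?_
    have ht0 : 0 ≤ t := hS.trans ht.1.le
    rw [norm_mul, Real.norm_of_nonneg (by positivity : 0 ≤ 2 * t / (t ^ 2 + x) ^ 2)]
    exact mul_le_of_le_one_left (by positivity) (Real.abs_sin_le_one _)
  have hb : ∀ t, 0 < t ^ 2 + x → |Real.sin (t ^ 3 / 3 + x * t) / (t ^ 2 + x)| ≤ 1 / (t ^ 2 + x) := by
    intro t ht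
    rw [abs_div, abs_of_pos ht]
    gcongr
    exact Real.abs_sin_le_one _
  have hT := abs_le.1 (hb T (hpos T right_mem_uIcc))
  have hS' := abs_le.1 (hb S hx)
  have h3' := abs_le.1 h3
  have e : 2 / (S ^ 2 + x) = 1 / (S ^ 2 + x) + 1 / (S ^ 2 + x) := by ring
  rw [abs_le, e]
  constructor <;> linarith [h3'.1, h3'.2, hT.1, hT.2, hS'.1, hS'.2]

lemma abs_airyPartial_le_self {T : ℝ} (hT : 0 ≤ T) (x : ℝ) : |airyPartial T x| ≤ T := by
  have := intervalIntegral.norm_integral_le_of_norm_le_const (a := 0) (b := T) (C := 1)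
    (f := fun t : ℝ => Real.cos (t ^ 3 / 3 + x * t)) fun t _ => Real.abs_cos_le_one _
  simpa [airyPartial, abs_of_nonneg hT] using this

/-- Up to `S = |c| + 1` the trivial bound suffices; beyond it `S² + x ≥ 1`, so the tail is at most
2. Uniformity in `T` is what dominated convergence needs later. -/
lemma abs_airyPartial_le {c x T : ℝ} (hT : 0 ≤ T) (hx : c ≤ x) :
    |airyPartial T x| ≤ |c| + 3 := by
  set S : ℝ := |c| + 1 with hSdef
  have hc := abs_nonneg c
  have hS : 0 ≤ S := by positivity
  rcases le_total T S with h | h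
  · exact (abs_airyPartial_le_self hT x).trans (by linarith)
  · have hpos : 1 ≤ S ^ 2 + x := by nlinarith [neg_abs_le c]
    have h1 := abs_airyPartial_sub_le hS h (lt_of_lt_of_le one_pos hpos)
    have h2 := abs_airyPartial_le_self hS x
    have h3 : 2 / (S ^ 2 + x) ≤ 2 := div_le_self (by norm_num) hpos
    have := abs_sub_abs_le_abs_sub (airyPartial T x) (airyPartial S x)
    linarith

lemma tendsto_sq_add_atTop (x : ℝ) : Tendsto (fun S : ℝ => S ^ 2 + x) atTop atTop :=
  tendsto_atTop_add_const_right _ _ (tendsto_pow_atTop (by norm_num))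

lemma exists_tendsto_airyPartial (x : ℝ) :
    ∃ l, Tendsto (fun T => airyPartial T x) atTop (𝓝 l) := by
  refine cauchySeq_tendsto_of_complete (u := fun T => airyPartial T x)
    (Metric.cauchySeq_iff'.2 fun ε hε => ?_)
  obtain ⟨N, hN, hN0⟩ := (((tendsto_sq_add_atTop x).eventually_ge_atTop (2 / ε + 1)).and
    (eventually_ge_atTop 0)).exists
  have hε2 : 0 < 2 / ε := by positivity
  refine ⟨N, fun T hT => ?_⟩
  rw [Real.dist_eq]
  refine (abs_airyPartial_sub_le hN0 hT (by linarith)).trans_lt ?_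
  rw [div_lt_iff₀ (by linarith)]
  have : 2 = ε * (2 / ε) := by field_simp
  nlinarith

lemma tendsto_airyPartial (x : ℝ) :
    Tendsto (fun T => 1 / Real.pi * airyPartial T x) atTop (𝓝 (airyAi x)) :=
  (tendsto_nhds_limUnder (exists_tendsto_airyPartial x)).const_mul _

lemma measurable_airyAi : Measurable airyAi := by
  refine measurable_of_tendsto_metrizable (f := fun (n : ℕ) x => 1 / Real.pi * airyPartial n x)
    (fun n => ((continuous_airyPartial n).const_mul _).measurable) ?_
  exact tendsto_pi_nhds.2 fun x => (tendsto_airyPartial x).comp tendsto_natCast_atTop_atTop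

lemma one_div_pi_mul_abs_le {r C : ℝ} (h : |r| ≤ C) : |1 / Real.pi * r| ≤ C := by
  rw [abs_mul, abs_of_pos (by positivity : 0 < 1 / Real.pi)]
  refine (mul_le_of_le_one_left (abs_nonneg r) ?_).trans h
  rw [div_le_one Real.pi_pos]
  linarith [Real.pi_gt_three]

lemma abs_airyAi_le {c x : ℝ} (hx : c ≤ x) : |airyAi x| ≤ |c| + 3 := by
  refine le_of_tendsto (tendsto_airyPartial x).abs ?_
  filter_upwards [eventually_ge_atTop 0] with T hT
  exact one_div_pi_mul_abs_le (abs_airyPartial_le hT hx)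

/-- Integrating by parts twice bounds the Airy integral for large arguments. -/
lemma abs_airyPartial_le_of_one_le {x T : ℝ} (hx : 1 ≤ x) (hT : 0 ≤ T) :
    |airyPartial T x| ≤ 3 / (T ^ 2 + x) + 28 / x ^ 2 := by
  have hpos : ∀ t : ℝ, 0 < t ^ 2 + x := fun t => by positivity
  -- With `φ` the phase, `φ' = t² + x`; two integrations by parts leave the boundary term `P` and
  -- the remainder `cos φ · k`, that is, `P' = cos φ - cos φ · k`.
  let k : ℝ → ℝ := fun t => 2 / (t ^ 2 + x) ^ 3 - 12 * t ^ 2 / (t ^ 2 + x) ^ 4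
  have hk : Continuous k :=
    (continuous_const.div (by fun_prop) fun t => (pow_pos (hpos t) 3).ne').sub
      (Continuous.div (by fun_prop) (by fun_prop) fun t => (pow_pos (hpos t) 4).ne')
  have hck : Continuous fun t : ℝ => Real.cos (t ^ 3 / 3 + x * t) * k t :=
    Continuous.mul (by fun_prop) hk
  let P : ℝ → ℝ := fun t => Real.sin (t ^ 3 / 3 + x * t) / (t ^ 2 + x) -
    Real.cos (t ^ 3 / 3 + x * t) * (2 * t) / (t ^ 2 + x) ^ 3
  have h1 : ∫ t in (0 : ℝ)..T, (Real.cos (t ^ 3 / 3 + x * t) -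
      Real.cos (t ^ 3 / 3 + x * t) * k t) = P T - P 0 := by
    refine intervalIntegral.integral_eq_sub_of_hasDerivAt ?_ ?_
    · intro t _
      have hne := (hpos t).ne'
      have hq := (hasDerivAt_pow 2 t).add_const x
      have := ((hasDerivAt_airyPhase x t).sin.div hq hne).sub
        (((hasDerivAt_airyPhase x t).cos.mul ((hasDerivAt_id t).const_mul 2)).div (hq.pow 3)
          (pow_pos (hpos t) 3).ne')
      convert! this using 1
      simp only [k, id, Pi.mul_apply]
      field_simp
      simp
      ring
    · exact (intervalIntegrable_airyPhase x 0 T).sub (hck.intervalIntegrable _ _)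
  rw [intervalIntegral.integral_sub (intervalIntegrable_airyPhase x 0 T)
    (hck.intervalIntegrable _ _)] at h1
  have hP0 : P 0 = 0 := by simp [P]
  have hPT : |P T| ≤ 3 / (T ^ 2 + x) := by
    have hq1 : 1 ≤ T ^ 2 + x := by nlinarith [sq_nonneg T]
    have a1 : |Real.sin (T ^ 3 / 3 + x * T) / (T ^ 2 + x)| ≤ 1 / (T ^ 2 + x) := by
      rw [abs_div, abs_of_pos (hpos T)]
      gcongr
      exact Real.abs_sin_le_one _
    have a2 : |Real.cos (T ^ 3 / 3 + x * T) * (2 * T) / (T ^ 2 + x) ^ 3| ≤ 2 / (T ^ 2 + x) := by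
      rw [abs_div, abs_mul, abs_of_pos (pow_pos (hpos T) 3), abs_of_nonneg (by positivity : 0 ≤ 2 * T),
        div_le_div_iff₀ (pow_pos (hpos T) 3) (hpos T)]
      have b1 : |Real.cos (T ^ 3 / 3 + x * T)| * (2 * T) ≤ 2 * T :=
        mul_le_of_le_one_left (by positivity) (Real.abs_cos_le_one _)
      have b2 : T ≤ T ^ 2 + x := by nlinarith [sq_nonneg (T - 1)]
      have b3 : (T ^ 2 + x) ^ 2 ≤ (T ^ 2 + x) ^ 3 := pow_le_pow_right₀ hq1 (by norm_num)
      have b4 := mul_le_mul_of_nonneg_right (b1.trans (by linarith : 2 * T ≤ 2 * (T ^ 2 + x)))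
        (hpos T).le
      linarith
    have e : 3 / (T ^ 2 + x) = 1 / (T ^ 2 + x) + 2 / (T ^ 2 + x) := by ring
    rw [e]
    exact (abs_sub _ _).trans (add_le_add a1 a2)
  -- `|k| ≤ (2 + 12)/(t² + x)³`, and `(t² + x)³ ≥ x² (1 + t²)` since `x ≥ 1`; then `arctan T ≤ 2`
  -- gives 28.
  have hbound : |∫ t in (0 : ℝ)..T, Real.cos (t ^ 3 / 3 + x * t) * k t| ≤ 28 / x ^ 2 := by
    have hint : IntervalIntegrable (fun t : ℝ => 14 / x ^ 2 * (1 + t ^ 2)⁻¹) volume 0 T :=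
      (continuous_const.mul (Continuous.inv₀ (by fun_prop) fun t => by positivity)).intervalIntegrable
        _ _
    have c1 : |∫ t in (0 : ℝ)..T, Real.cos (t ^ 3 / 3 + x * t) * k t| ≤
        ∫ t in (0 : ℝ)..T, 14 / x ^ 2 * (1 + t ^ 2)⁻¹ := by
      rw [← Real.norm_eq_abs]
      refine intervalIntegral.norm_integral_le_of_norm_le hT ?_ hint
      refine Eventually.of_forall fun t ht => ?_
      rw [norm_mul]
      refine (mul_le_of_le_one_left (norm_nonneg _) (Real.abs_cos_le_one _)).trans ?_
      have hq := hpos t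
      have d1 : 12 * t ^ 2 / (t ^ 2 + x) ^ 4 ≤ 12 / (t ^ 2 + x) ^ 3 := by
        rw [div_le_div_iff₀ (by positivity) (by positivity)]
        have : t ^ 2 * (t ^ 2 + x) ^ 3 ≤ (t ^ 2 + x) * (t ^ 2 + x) ^ 3 := by gcongr; linarith
        linarith
      have d2 : |k t| ≤ 14 / (t ^ 2 + x) ^ 3 := by
        refine (abs_sub _ _).trans ?_
        rw [abs_of_nonneg (by positivity), abs_of_nonneg (by positivity)]
        have e : 14 / (t ^ 2 + x) ^ 3 = 2 / (t ^ 2 + x) ^ 3 + 12 / (t ^ 2 + x) ^ 3 := by ring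
        linarith
      refine d2.trans ?_
      rw [← div_eq_mul_inv, div_div]
      have e : (t ^ 2 + x) ^ 3 = (t ^ 2 + x) ^ 2 * (t ^ 2 + x) := by ring
      rw [e, add_comm 1 (t ^ 2)]
      gcongr
      nlinarith [sq_nonneg t]
    refine c1.trans ?_
    rw [intervalIntegral.integral_const_mul, integral_inv_one_add_sq, Real.arctan_zero, sub_zero]
    have : Real.arctan T ≤ 2 := by linarith [Real.arctan_lt_pi_div_two T, Real.pi_le_four]
    calc 14 / x ^ 2 * Real.arctan T ≤ 14 / x ^ 2 * 2 := by gcongr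
      _ = 28 / x ^ 2 := by ring
  have e : airyPartial T x = P T + ∫ t in (0 : ℝ)..T, Real.cos (t ^ 3 / 3 + x * t) * k t := by
    rw [airyPartial]; linarith
  rw [e]
  exact (abs_add_le _ _).trans (add_le_add hPT hbound)

lemma abs_airyAi_le_of_one_le {x : ℝ} (hx : 1 ≤ x) : |airyAi x| ≤ 28 / x ^ 2 := by
  have h : Tendsto (fun T : ℝ => 3 / (T ^ 2 + x) + 28 / x ^ 2) atTop (𝓝 (0 + 28 / x ^ 2)) :=
    ((tendsto_sq_add_atTop x).const_div_atTop 3).add_const _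
  rw [zero_add] at h
  refine le_of_tendsto_of_tendsto (tendsto_airyPartial x).abs h ?_
  filter_upwards [eventually_ge_atTop 0] with T hT
  exact one_div_pi_mul_abs_le (abs_airyPartial_le_of_one_le hx hT)

/-! ### Decay and square integrability of the kernel -/

lemma exists_abs_airyAi_le (c : ℝ) : ∃ D, ∀ s, c ≤ s → |airyAi s| ≤ D / (1 + (s - c)) ^ 2 := by
  -- Beyond `m` the quadratic decay applies and `1 + (s - c) ≤ 2s`, whence `112 = 4 · 28`; on `[c,
  -- m]` the constant bound is enough.
  set m : ℝ := max 1 (1 - c)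
  refine ⟨max 112 ((|c| + 3) * (m + 1 - c) ^ 2), fun s hs => ?_⟩
  have hu : 0 < 1 + (s - c) := by linarith
  rcases le_total m s with h | h
  · have h1 : 1 ≤ s := (le_max_left _ _).trans h
    have h2 : 1 - c ≤ s := (le_max_right _ _).trans h
    refine (abs_airyAi_le_of_one_le h1).trans ?_
    calc 28 / s ^ 2 = 112 / (2 * s) ^ 2 := by field_simp; norm_num
      _ ≤ 112 / (1 + (s - c)) ^ 2 := by gcongr; linarith
      _ ≤ _ := by gcongr; exact le_max_left _ _
  · rw [le_div_iff₀ (by positivity)]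
    refine le_trans ?_ (le_max_right _ _)
    have := abs_airyAi_le hs
    gcongr
    linarith

/-- The square of the Airy kernel is integrable on every quadrant. -/
lemma integrableOn_airyAi_sq (a b : ℝ) :
    IntegrableOn (fun p : ℝ × ℝ => airyAi (p.1 + p.2) ^ 2) (Ioi b ×ˢ Ioi a) := by
  obtain ⟨D, hD⟩ := exists_abs_airyAi_le (b + a)
  have hint : Integrable (fun p : ℝ × ℝ => D ^ 2 * ((1 + (p.1 - b) ^ 2)⁻¹ * (1 + (p.2 - a) ^ 2)⁻¹)) :=
    ((integrable_inv_one_add_sq.comp_sub_right b).mul_prod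
      (integrable_inv_one_add_sq.comp_sub_right a)).const_mul _
  refine Integrable.mono' hint.integrableOn
    ((measurable_airyAi.comp (by fun_prop)).pow_const 2).aestronglyMeasurable ?_
  refine (ae_restrict_iff' (measurableSet_Ioi.prod measurableSet_Ioi)).2
    (Eventually.of_forall fun p hp => ?_)
  have hp1 : 0 < p.1 - b := sub_pos.2 hp.1
  have hp2 : 0 < p.2 - a := sub_pos.2 hp.2
  have h := hD (p.1 + p.2) (by linarith)
  set u := p.1 - b
  set v := p.2 - a
  have e : p.1 + p.2 - (b + a) = u + v := by simp only [u, v]; ring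
  rw [e] at h
  rw [Real.norm_of_nonneg (sq_nonneg _), ← sq_abs, ← mul_inv, ← div_eq_mul_inv]
  calc |airyAi (p.1 + p.2)| ^ 2 ≤ (D / (1 + (u + v)) ^ 2) ^ 2 := by gcongr
    _ = D ^ 2 / (1 + (u + v)) ^ 4 := by rw [div_pow, ← pow_mul]
    _ ≤ D ^ 2 / ((1 + u ^ 2) * (1 + v ^ 2)) := by
      gcongr
      -- The fourth power splits into two squares, one to control each variable.
      have h1 : 1 + u ^ 2 ≤ (1 + (u + v)) ^ 2 := by nlinarith
      have h2 : 1 + v ^ 2 ≤ (1 + (u + v)) ^ 2 := by nlinarith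
      calc _ ≤ (1 + (u + v)) ^ 2 * (1 + (u + v)) ^ 2 := by gcongr
        _ = _ := by ring

/-- The Airy function is square integrable on every half-line. -/
lemma memLp_airyAi_add (a x : ℝ) : MemLp (fun y => airyAi (x + y)) 2 (volume.restrict (Ioi a)) := by
  have hm : Measurable fun y => airyAi (x + y) := measurable_airyAi.comp (by fun_prop)
  rw [memLp_two_iff_integrable_sq hm.aestronglyMeasurable]
  obtain ⟨D, hD⟩ := exists_abs_airyAi_le (x + a)
  have hint : Integrable (fun y : ℝ => D ^ 2 * (1 + (y - a) ^ 2)⁻¹) :=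
    (integrable_inv_one_add_sq.comp_sub_right a).const_mul _
  refine Integrable.mono' hint.integrableOn
    ((measurable_airyAi.comp (by fun_prop)).pow_const 2).aestronglyMeasurable ?_
  refine (ae_restrict_iff' measurableSet_Ioi).2 (Eventually.of_forall fun y hy => ?_)
  have hy' : 0 < y - a := sub_pos.2 hy
  have h := hD (x + y) (by linarith)
  rw [add_sub_add_left_eq_sub] at h
  set v := y - a
  rw [Real.norm_of_nonneg (sq_nonneg _), ← sq_abs, ← div_eq_mul_inv]
  calc |airyAi (x + y)| ^ 2 ≤ (D / (1 + v) ^ 2) ^ 2 := by gcongr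
    _ = D ^ 2 / (1 + v) ^ 4 := by rw [div_pow, ← pow_mul]
    _ ≤ D ^ 2 / (1 + v ^ 2) := by
      gcongr
      calc 1 + v ^ 2 ≤ (1 + v) ^ 2 := by nlinarith
        _ ≤ (1 + v) ^ 4 := pow_le_pow_right₀ (by linarith) (by norm_num)

/-! ### Inverse Fourier transform on `L²` and truncation -/

lemma continuous_fourierInv_of_integrable {g : ℝ → ℂ} (hg : Integrable g) : Continuous (𝓕⁻ g) :=
  VectorFourier.fourierIntegral_continuous Real.continuous_fourierChar (by fun_prop) hg

/-- The inverse Fourier integral is self-adjoint for the bilinear pairing. -/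
lemma integral_fourierInv_smul_eq_of_integrable {f g : ℝ → ℂ} (hf : Integrable f)
    (hg : Integrable g) : ∫ x, (𝓕⁻ f) x • g x = ∫ x, f x • (𝓕⁻ g) x := by
  have h := VectorFourier.integral_fourierIntegral_smul_eq_flip (L := -innerₗ ℝ)
    Real.continuous_fourierChar (by fun_prop) hf hg
  have e : (-innerₗ ℝ).flip = -innerₗ ℝ := by
    ext; simp
  rw [e] at h
  exact h

/-- On `L¹ ∩ L²` the inverse `L²` Fourier transform is given by the inverse Fourier integral. -/
lemma MeasureTheory.MemLp.coeFn_fourierInv_toLp {g : ℝ → ℂ} (h1 : Integrable g) (h2 : MemLp g 2) :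
    (𝓕⁻ (h2.toLp g) : Lp ℂ 2 (volume : Measure ℝ)) =ᵐ[volume] 𝓕⁻ g := by
  refine ae_eq_of_integral_contDiff_smul_eq
    ((Lp.memLp _).locallyIntegrable (by norm_num))
    (continuous_fourierInv_of_integrable h1).locallyIntegrable ?_
  intro φ hφ hφc
  have hg₁ : HasCompactSupport (Complex.ofRealCLM ∘ φ) := hφc.comp_left rfl
  have hg₂ : ContDiff ℝ (⊤ : ℕ∞) (Complex.ofRealCLM ∘ φ) := by fun_prop
  let ψ : 𝓢(ℝ, ℂ) := hg₁.toSchwartzMap hg₂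
  have hψ : ∀ x, ψ x = (φ x : ℂ) := fun x => rfl
  -- Both sides are compared as tempered distributions, tested against `ψ`.
  have key := congrArg (fun F : 𝓢'(ℝ, ℂ) => F ψ)
    (Lp.fourierInv_toTemperedDistribution_eq (h2.toLp g))
  simp only [TemperedDistribution.fourierInv_apply, Lp.toTemperedDistribution_apply] at key
  have e1 : ∀ h : ℝ → ℂ, ∫ x, φ x • h x = ∫ x, ψ x • h x := by
    intro h; simp [hψ]
  rw [e1, e1, ← key]
  have e2 : ∫ x, (𝓕⁻ ψ) x • (h2.toLp g) x = ∫ x, (𝓕⁻ (ψ : ℝ → ℂ)) x • g x := by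
    refine integral_congr_ae ?_
    filter_upwards [h2.coeFn_toLp] with x hx
    rw [hx, SchwartzMap.fourierInv_coe]
  rw [e2]
  exact integral_fourierInv_smul_eq_of_integrable ψ.integrable h1

/-- Truncations to `[-n, n]` converge in `L²`. -/
lemma MeasureTheory.MemLp.tendsto_eLpNorm_sub_indicator_Icc {g : ℝ → ℂ} (hg : MemLp g 2) :
    Tendsto (fun n : ℕ => eLpNorm (fun x => (Icc (-n : ℝ) n).indicator g x - g x) 2) atTop (𝓝 0) := by
  have h : Tendsto (fun n : ℕ => ∫⁻ x, ‖(Icc (-n : ℝ) n).indicator g x - g x‖ₑ ^ (2 : ℝ)) atTop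
      (𝓝 (∫⁻ _ : ℝ, 0)) := by
    refine tendsto_lintegral_of_dominated_convergence' (fun x => ‖g x‖ₑ ^ (2 : ℝ)) ?_ ?_ ?_ ?_
    · intro n
      exact ((hg.1.indicator measurableSet_Icc).sub hg.1).enorm.pow_const _
    · intro n
      refine Eventually.of_forall fun x => ENNReal.rpow_le_rpow ?_ (by norm_num)
      by_cases hx : x ∈ Icc (-n : ℝ) n <;> simp [hx]
    · have := lintegral_rpow_enorm_lt_top_of_eLpNorm_lt_top (by norm_num) (by norm_num) hg.2
      simpa using this.ne
    · refine Eventually.of_forall fun x => tendsto_const_nhds.congr' ?_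
      filter_upwards [eventually_ge_atTop ⌈|x|⌉₊] with n hn
      have hx : x ∈ Icc (-n : ℝ) n := abs_le.1 (Nat.ceil_le.1 hn)
      simp [hx]
  rw [lintegral_zero] at h
  have h2 := (ENNReal.continuous_rpow_const (y := 1 / 2)).continuousAt.tendsto.comp h
  rw [ENNReal.zero_rpow_of_pos (by norm_num)] at h2
  refine h2.congr fun n => ?_
  rw [eLpNorm_eq_lintegral_rpow_enorm_toReal (by norm_num) (by norm_num)]
  simp

/-! ### The Airy transform as a Fourier multiplier -/

/-- The symbol of the Airy transform. -/
noncomputable def airySymbol (u : ℝ) : ℂ :=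
  Complex.exp (((2 * Real.pi * u) ^ 3 / 3 : ℝ) * Complex.I)

lemma norm_airySymbol (u : ℝ) : ‖airySymbol u‖ = 1 := Complex.norm_exp_ofReal_mul_I _

lemma continuous_airySymbol : Continuous airySymbol := by
  unfold airySymbol
  fun_prop

/-- The truncation of the symbol of the Airy transform to `[-n, n]`. -/
noncomputable def airySymbolTrunc (n : ℕ) : ℝ → ℂ := (Icc (-n : ℝ) n).indicator airySymbol

lemma integrable_airySymbolTrunc (n : ℕ) : Integrable (airySymbolTrunc n) :=
  (integrable_indicator_iff measurableSet_Icc).2 continuous_airySymbol.continuousOn.integrableOn_Icc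

/-- Substitute `t = 2πu`; the phase is odd, so the two halves of the integral fold into twice a
cosine. -/
lemma fourierInv_airySymbolTrunc (n : ℕ) (x : ℝ) :
    𝓕⁻ (airySymbolTrunc n) x = ((1 / Real.pi * airyPartial (2 * Real.pi * n) x : ℝ) : ℂ) := by
  have hpi := Real.pi_pos
  let F : ℝ → ℂ := fun t => Complex.exp ((t ^ 3 / 3 + x * t : ℝ) * Complex.I)
  have hF : Continuous F := by fun_prop
  have hI : ∀ a b, IntervalIntegrable F volume a b := fun a b => hF.intervalIntegrable a b
  have h1 : 𝓕⁻ (airySymbolTrunc n) x = ∫ u in (-n : ℝ)..n, F (2 * Real.pi * u) := by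
    rw [Real.fourierInv_eq', intervalIntegral.integral_of_le (by simp), ← integral_Icc_eq_integral_Ioc,
      ← integral_indicator measurableSet_Icc]
    refine integral_congr_ae (Eventually.of_forall fun u => ?_)
    simp only [airySymbolTrunc, Set.indicator_apply]
    split_ifs
    · simp only [airySymbol, F, smul_eq_mul, ← Complex.exp_add]
      congr 1
      simp
      ring
    · simp
  have h2 : ∫ t in -(2 * Real.pi * n)..(2 * Real.pi * n), F t =
      ((2 * airyPartial (2 * Real.pi * n) x : ℝ) : ℂ) := by
    rw [← intervalIntegral.integral_add_adjacent_intervals (hI _ 0) (hI 0 _),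
      ← neg_zero, ← intervalIntegral.integral_comp_neg, neg_zero,
      ← intervalIntegral.integral_add]
    · rw [airyPartial, ← intervalIntegral.integral_const_mul, ← intervalIntegral.integral_ofReal]
      refine intervalIntegral.integral_congr fun t _ => ?_
      simp only [F, Complex.ofReal_mul, Complex.ofReal_cos, Complex.ofReal_ofNat, Complex.two_cos]
      rw [add_comm]
      congr 2
      push_cast
      ring
    · exact Continuous.intervalIntegrable (by fun_prop) _ _
    · exact hI _ _
  rw [h1, intervalIntegral.integral_comp_mul_left F (by positivity), mul_neg, h2,
    Complex.real_smul, ← Complex.ofReal_mul]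
  congr 1
  field_simp

/-- Modulating the truncated symbol by `e` translates its inverse transform by `x`; self-adjointness
then moves the other inverse transform off `s`. -/
lemma fourierInv_airySymbolTrunc_mul {n : ℕ} {s : ℝ → ℂ} (hs : Integrable s) (x : ℝ) :
    𝓕⁻ (fun u => airySymbolTrunc n u * (𝓕⁻ s) u) x =
      ∫ y, ((1 / Real.pi * airyPartial (2 * Real.pi * n) (x + y) : ℝ) : ℂ) * s y := by
  let e : ℝ → ℂ := fun u => Complex.exp ((2 * Real.pi * (u * x) : ℝ) * Complex.I)
  have he : Continuous e := by fun_prop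
  have hne : ∀ u, ‖e u‖ = 1 := fun u => Complex.norm_exp_ofReal_mul_I _
  have hint : Integrable fun u => e u * airySymbolTrunc n u :=
    (integrable_airySymbolTrunc n).bdd_mul he.aestronglyMeasurable
      (Eventually.of_forall fun u => (hne u).le)
  have hF : ∀ y, 𝓕⁻ (fun u => e u * airySymbolTrunc n u) y =
      ((1 / Real.pi * airyPartial (2 * Real.pi * n) (x + y) : ℝ) : ℂ) := by
    intro y
    rw [← fourierInv_airySymbolTrunc, Real.fourierInv_eq', Real.fourierInv_eq']
    refine integral_congr_ae (Eventually.of_forall fun u => ?_)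
    simp only [e, smul_eq_mul, ← mul_assoc, ← Complex.exp_add]
    congr 2
    simp
    ring
  have h := integral_fourierInv_smul_eq_of_integrable hint hs
  simp only [hF, smul_eq_mul] at h
  rw [h, Real.fourierInv_eq']
  refine integral_congr_ae (Eventually.of_forall fun u => ?_)
  simp only [e, smul_eq_mul, ← mul_assoc]
  congr 3
  simp
  ring

lemma MeasureTheory.MemLp.airySymbol_mul {g : ℝ → ℂ} (hg : MemLp g 2) :
    MemLp (fun u => airySymbol u * g u) 2 :=
  (memLp_congr_norm (continuous_airySymbol.aestronglyMeasurable.mul hg.1) hg.1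
    (Eventually.of_forall fun u => by simp [norm_airySymbol])).2 hg

/-- Multiplication by the symbol of the Airy transform on `L²`. -/
noncomputable def airySymbolMul (g : Lp ℂ 2 (volume : Measure ℝ)) : Lp ℂ 2 (volume : Measure ℝ) :=
  (Lp.memLp g).airySymbol_mul.toLp _

lemma isometry_airySymbolMul : Isometry airySymbolMul := by
  intro g h
  rw [airySymbolMul, airySymbolMul, Lp.edist_toLp_toLp, Lp.edist_def]
  refine eLpNorm_congr_norm_ae (Eventually.of_forall fun u => ?_)
  simp [← mul_sub, norm_airySymbol]

/-- The Airy transform on `L²`, as a Fourier multiplier. -/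
noncomputable def airyTransform (g : Lp ℂ 2 (volume : Measure ℝ)) : Lp ℂ 2 (volume : Measure ℝ) :=
  𝓕⁻ (airySymbolMul (𝓕⁻ g))

lemma isometry_airyTransform : Isometry airyTransform :=
  ((Lp.fourierTransformₗᵢ ℝ ℂ).symm.isometry.comp isometry_airySymbolMul).comp
    (Lp.fourierTransformₗᵢ ℝ ℂ).symm.isometry

lemma norm_airyTransform (g : Lp ℂ 2 (volume : Measure ℝ)) : ‖airyTransform g‖ = ‖g‖ := by
  have h0 : airySymbolMul 0 = 0 := by
    rw [← norm_eq_zero, airySymbolMul, Lp.norm_toLp]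
    have : eLpNorm (fun u => airySymbol u * (0 : Lp ℂ 2 (volume : Measure ℝ)) u) 2 =
        eLpNorm (0 : ℝ → ℂ) 2 := by
      refine eLpNorm_congr_ae ?_
      filter_upwards [Lp.coeFn_zero ℂ 2 (volume : Measure ℝ)] with u hu
      rw [hu, Pi.zero_apply, mul_zero]
    rw [this]; simp
  have h1 : airyTransform 0 = 0 := by
    change (Lp.fourierTransformₗᵢ ℝ ℂ).symm (airySymbolMul ((Lp.fourierTransformₗᵢ ℝ ℂ).symm 0)) = 0
    rw [map_zero, h0, map_zero]
  have := isometry_airyTransform.dist_eq g 0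
  rwa [h1, dist_zero_right, dist_zero_right] at this

/-! ### Kernel formula for the Airy transform -/

/-- An `L²` limit agrees with the pointwise limit. -/
lemma MeasureTheory.Lp.ae_eq_of_tendsto {F : ℕ → Lp ℂ 2 (volume : Measure ℝ)}
    {G : Lp ℂ 2 (volume : Measure ℝ)} {φ : ℝ → ℂ} (hF : Tendsto F atTop (𝓝 G))
    (hφ : ∀ᵐ x, Tendsto (fun n => F n x) atTop (𝓝 (φ x))) : G =ᵐ[volume] φ := by
  obtain ⟨ns, hns, h⟩ := (tendstoInMeasure_of_tendsto_Lp hF).exists_seq_tendsto_ae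
  filter_upwards [h, hφ] with x h1 h2
  exact tendsto_nhds_unique h1 (h2.comp hns.tendsto_atTop)

lemma MeasureTheory.MemLp.tendsto_toLp_indicator_Icc {g : ℝ → ℂ} (hg : MemLp g 2) :
    Tendsto (fun n : ℕ => (hg.indicator (measurableSet_Icc (a := (-n : ℝ)) (b := n))).toLp _) atTop
      (𝓝 (hg.toLp g)) :=
  (Lp.tendsto_Lp_iff_tendsto_eLpNorm'' _ _ _ _).2 hg.tendsto_eLpNorm_sub_indicator_Icc

/-- For compactly supported functions the Airy transform is given by the Airy kernel. -/
lemma coeFn_airyTransform_of_compact {s : ℝ → ℂ} (hs : MemLp s 2) {R : ℝ}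
    (hsR : ∀ y, R < |y| → s y = 0) :
    airyTransform (hs.toLp s) =ᵐ[volume] fun x => ∫ y, (airyAi (x + y) : ℂ) * s y := by
  have hs1 : Integrable s := by
    have : s = (Icc (-R) R).indicator s := by
      refine (Set.indicator_eq_self.2 fun y hy => ?_).symm
      by_contra h
      exact hy (hsR y (not_le.1 fun h' => h (abs_le.1 h')))
    rw [this, integrable_indicator_iff measurableSet_Icc]
    exact (hs.restrict _).integrable (by norm_num)
  have hae := hs.coeFn_fourierInv_toLp hs1
  have hinv : MemLp (𝓕⁻ s) 2 := (Lp.memLp _).ae_eq hae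
  have hg := hinv.airySymbol_mul
  have hG : airySymbolMul (𝓕⁻ (hs.toLp s)) = hg.toLp _ := by
    refine MemLp.toLp_congr _ _ ?_
    filter_upwards [hae] with u hu
    rw [hu]
  rw [airyTransform, hG]
  refine Lp.ae_eq_of_tendsto ((Lp.fourierTransformₗᵢ ℝ ℂ).symm.continuous.continuousAt.tendsto.comp
    hg.tendsto_toLp_indicator_Icc) ?_
  have hind : ∀ n : ℕ, (Icc (-n : ℝ) n).indicator (fun u => airySymbol u * (𝓕⁻ s) u) =
      fun u => airySymbolTrunc n u * (𝓕⁻ s) u := fun n => by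
    ext u
    simp only [airySymbolTrunc, Set.indicator_apply]
    split_ifs <;> simp
  have hpt : ∀ᵐ x, ∀ n : ℕ,
      (𝓕⁻ ((hg.indicator (measurableSet_Icc (a := (-n : ℝ)) (b := n))).toLp _) :
        Lp ℂ 2 (volume : Measure ℝ)) x =
      ∫ y, ((1 / Real.pi * airyPartial (2 * Real.pi * n) (x + y) : ℝ) : ℂ) * s y := by
    refine ae_all_iff.2 fun n => ?_
    have hi : Integrable ((Icc (-n : ℝ) n).indicator (fun u => airySymbol u * (𝓕⁻ s) u)) :=
      (integrable_indicator_iff measurableSet_Icc).2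
        (continuous_airySymbol.mul
          (continuous_fourierInv_of_integrable hs1)).continuousOn.integrableOn_Icc
    filter_upwards [(hg.indicator (measurableSet_Icc (a := (-n : ℝ)) (b := n))).coeFn_fourierInv_toLp
      hi] with x hx
    rw [hx, hind, fourierInv_airySymbolTrunc_mul hs1]
  filter_upwards [hpt] with x hx
  change Tendsto (fun n : ℕ =>
    (𝓕⁻ ((hg.indicator (measurableSet_Icc (a := (-n : ℝ)) (b := n))).toLp _) :
        Lp ℂ 2 (volume : Measure ℝ)) x) _ _
  simp only [hx]
  -- Where `s y ≠ 0`, `x + y ≥ x - R`, so the bound uniform in the truncation applies with `c = x -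
  -- R`.
  refine tendsto_integral_of_dominated_convergence (fun y => (|x - R| + 3) * ‖s y‖) ?_
    (hs1.norm.const_mul _) ?_ ?_
  · intro n
    have : Continuous fun y => airyPartial (2 * Real.pi * n) (x + y) :=
      (continuous_airyPartial _).comp (by fun_prop)
    exact (Continuous.aestronglyMeasurable (by fun_prop)).mul hs1.1
  · refine fun n => Eventually.of_forall fun y => ?_
    rw [norm_mul, Complex.norm_real]
    by_cases hy : R < |y|
    · simp [hsR y hy]
    · have : x - R ≤ x + y := by linarith [neg_abs_le y]
      gcongr
      exact one_div_pi_mul_abs_le (abs_airyPartial_le (by positivity) this)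
  · refine Eventually.of_forall fun y => Tendsto.mul_const _ ?_
    refine (Complex.continuous_ofReal.tendsto _).comp ((tendsto_airyPartial (x + y)).comp ?_)
    exact tendsto_natCast_atTop_atTop.const_mul_atTop (by positivity)

lemma integrable_airyAi_mul {a : ℝ} {s : ℝ → ℂ} (hs : MemLp s 2) (hsa : ∀ y ≤ a, s y = 0) (x : ℝ) :
    Integrable fun y => (airyAi (x + y) : ℂ) * s y := by
  have h : IntegrableOn (fun y => (airyAi (x + y) : ℂ) * s y) (Ioi a) :=
    MemLp.integrable_mul (p := 2) (q := 2) (memLp_airyAi_add a x).ofReal (hs.restrict _)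
  refine (integrableOn_iff_integrable_of_support_subset fun y hy => ?_).1 h
  by_contra hya
  exact hy (by simp [hsa y (not_lt.1 hya)])

/-- For functions supported on a right half-line the Airy transform is given by the Airy kernel. -/
lemma coeFn_airyTransform {a : ℝ} {s : ℝ → ℂ} (hs : MemLp s 2) (hsa : ∀ y ≤ a, s y = 0) :
    airyTransform (hs.toLp s) =ᵐ[volume] fun x => ∫ y, (airyAi (x + y) : ℂ) * s y := by
  refine Lp.ae_eq_of_tendsto (isometry_airyTransform.continuous.continuousAt.tendsto.comp
    hs.tendsto_toLp_indicator_Icc) ?_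
  have hpt : ∀ᵐ x, ∀ n : ℕ,
      airyTransform ((hs.indicator (measurableSet_Icc (a := (-n : ℝ)) (b := n))).toLp _) x =
      ∫ y, (airyAi (x + y) : ℂ) * (Icc (-n : ℝ) n).indicator s y :=
    ae_all_iff.2 fun n => coeFn_airyTransform_of_compact _ (R := n) fun y hy =>
      Set.indicator_of_notMem (fun h : y ∈ Icc (-n : ℝ) n => (abs_le.2 h).not_gt hy) _
  filter_upwards [hpt] with x hx
  simp only [Function.comp_apply, hx]
  have hint := integrable_airyAi_mul hs hsa x
  have hm : Measurable fun y => airyAi (x + y) := measurable_airyAi.comp (by fun_prop)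
  refine tendsto_integral_of_dominated_convergence _ ?_ hint.norm ?_ ?_
  · exact fun n => (Complex.measurable_ofReal.comp hm).aestronglyMeasurable.mul
      (hs.1.indicator measurableSet_Icc)
  · refine fun n => Eventually.of_forall fun y => ?_
    rw [norm_mul, norm_mul]
    gcongr
    exact norm_indicator_le_norm_self _ _
  · refine Eventually.of_forall fun y => tendsto_const_nhds.congr' ?_
    filter_upwards [eventually_ge_atTop ⌈|y|⌉₊] with n hn
    have hy : y ∈ Icc (-n : ℝ) n := abs_le.1 (Nat.ceil_le.1 hn)
    simp [hy]

/-! ### Plancherel, Cauchy–Schwarz and the uncertainty principle -/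

lemma MeasureTheory.Lp.norm_sq_eq_integral (g : Lp ℂ 2 (volume : Measure ℝ)) :
    ‖g‖ ^ 2 = ∫ x, ‖g x‖ ^ 2 := by
  have h := L2.inner_def (𝕜 := ℂ) g g
  simp only [inner_self_eq_norm_sq_to_K] at h
  have h2 : ((‖g‖ ^ 2 : ℝ) : ℂ) = ((∫ x, ‖g x‖ ^ 2 : ℝ) : ℂ) := by
    rw [← integral_complex_ofReal]
    simpa using h
  exact_mod_cast h2

/-- Plancherel's theorem for Airy-bandlimited functions. -/
lemma memLp_and_integral_sq_of_airyBandlimited {a : ℝ} {σ f : ℝ → ℝ}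
    (hσ : MemLp σ 2 (volume.restrict (Ioi a)))
    (hf : ∀ x, f x = ∫ y in Ioi a, airyAi (x + y) * σ y) :
    Integrable (fun x => f x ^ 2) ∧ ∫ x, f x ^ 2 = ∫ y in Ioi a, σ y ^ 2 := by
  let s : ℝ → ℂ := (Ioi a).indicator fun y => (σ y : ℂ)
  have hs : MemLp s 2 := (memLp_indicator_iff_restrict measurableSet_Ioi).2 hσ.ofReal
  have hsa : ∀ y ≤ a, s y = 0 := fun y hy => Set.indicator_of_notMem (notMem_Ioi.2 hy) _
  have hfs : airyTransform (hs.toLp s) =ᵐ[volume] fun x => (f x : ℂ) := by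
    filter_upwards [coeFn_airyTransform hs hsa] with x hx
    rw [hx, hf, ← integral_complex_ofReal, ← integral_indicator measurableSet_Ioi]
    congr 1 with y
    simp only [s, Set.indicator_apply]
    split_ifs <;> simp
  have hmem : MemLp (fun x => (f x : ℂ)) 2 := (Lp.memLp _).ae_eq hfs
  have hf2 : MemLp f 2 := by simpa using hmem.re
  refine ⟨hf2.integrable_sq, ?_⟩
  have h1 : ∫ x, ‖airyTransform (hs.toLp s) x‖ ^ 2 = ∫ x, f x ^ 2 := by
    refine integral_congr_ae ?_
    filter_upwards [hfs] with x hx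
    simp [hx]
  have h2 : ∫ x, ‖hs.toLp s x‖ ^ 2 = ∫ y in Ioi a, σ y ^ 2 := by
    rw [← integral_indicator measurableSet_Ioi]
    refine integral_congr_ae ?_
    filter_upwards [hs.coeFn_toLp] with x hx
    rw [hx]
    simp only [s, Set.indicator_apply]
    split_ifs <;> simp
  rw [← h1, ← h2, ← Lp.norm_sq_eq_integral, ← Lp.norm_sq_eq_integral, norm_airyTransform]

lemma sq_integral_mul_le {μ : Measure ℝ} {g h : ℝ → ℝ} (hg : MemLp g 2 μ) (hh : MemLp h 2 μ) :
    (∫ y, g y * h y ∂μ) ^ 2 ≤ (∫ y, g y ^ 2 ∂μ) * ∫ y, h y ^ 2 ∂μ := by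
  have key := integral_mul_norm_le_Lp_mul_Lq (μ := μ) (f := g) (g := h) Real.HolderConjugate.two_two
    (by simpa using hg) (by simpa using hh)
  have h1 : |∫ y, g y * h y ∂μ| ≤ ∫ y, ‖g y‖ * ‖h y‖ ∂μ := by
    refine (norm_integral_le_integral_norm (fun y => g y * h y)).trans_eq ?_
    simp
  have h2 := h1.trans key
  rw [← Real.sqrt_eq_rpow, ← Real.sqrt_eq_rpow] at h2
  simp only [Real.rpow_two, Real.norm_eq_abs, sq_abs] at h2
  have A : 0 ≤ ∫ y, g y ^ 2 ∂μ := integral_nonneg fun y => sq_nonneg _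
  have B : 0 ≤ ∫ y, h y ^ 2 ∂μ := integral_nonneg fun y => sq_nonneg _
  rw [← Real.sqrt_mul A] at h2
  rw [← sq_abs]
  exact (Real.le_sqrt (abs_nonneg _) (mul_nonneg A B)).1 h2

theorem theorem3p6 (a b : ℝ) (σ f : ℝ → ℝ) (hf : IsAiryBandlimited a σ f)
    (hf0 : ∃ x, f x ≠ 0) :
    MeasureTheory.Integrable (fun x : ℝ => f x ^ 2) ∧
    (0 < ∫ x : ℝ, f x ^ 2) ∧
    MeasureTheory.IntegrableOn (fun p : ℝ × ℝ => airyAi (p.1 + p.2) ^ 2)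
      (Set.Ioi b ×ˢ Set.Ioi a) ∧
    (∫ x in Set.Ioi b, f x ^ 2) / (∫ x : ℝ, f x ^ 2) ≤
      ∫ x in Set.Ioi b, ∫ y in Set.Ioi a, airyAi (x + y) ^ 2 := by
  have hσ : MemLp σ 2 (volume.restrict (Ioi a)) := hf.memLp.restrict _
  obtain ⟨hint, heq⟩ := memLp_and_integral_sq_of_airyBandlimited hσ hf.eq_integral
  have hle : ∀ x, f x ^ 2 ≤ (∫ y in Ioi a, airyAi (x + y) ^ 2) * ∫ x, f x ^ 2 := fun x => by
    rw [heq, hf.eq_integral]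
    exact sq_integral_mul_le (memLp_airyAi_add a x) hσ
  have hpos : 0 < ∫ x, f x ^ 2 := by
    obtain ⟨x, hx⟩ := hf0
    refine lt_of_le_of_ne (integral_nonneg fun y => sq_nonneg _) fun h => ?_
    -- Zero total energy would force `f x ^ 2 ≤ 0` at a point where `f x ≠ 0`.
    have := hle x
    rw [← h, mul_zero] at this
    exact this.not_gt (by positivity)
  have hA := integrableOn_airyAi_sq a b
  refine ⟨hint, hpos, hA, ?_⟩
  have hA' : IntegrableOn (fun x => ∫ y in Ioi a, airyAi (x + y) ^ 2) (Ioi b) := by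
    rw [IntegrableOn, Measure.volume_eq_prod, ← Measure.prod_restrict] at hA
    exact hA.integral_prod_left
  rw [div_le_iff₀ hpos, ← integral_mul_const]
  exact integral_mono hint.integrableOn (hA'.mul_const _) hle
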